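/- Conventions. A discrete signal is a function $x:\mathbb Z\to\mathbb C$; write $\operatorname{sinc}(s)=\frac{\sin \pi s}{\pi s}$, $\operatorname{sinc}(0)=1$. For $B>0$ a function $z:\mathbb R\to\mathbb C$ is called $B$-bandlimited if $z(t)=c+\int_{-B}^{B}Z(\omega)e^{2\pi i\omega t}\,d\omega$ for some $c\in\mathbb C$ and $Z\in L^2([-B,B])$ (a finite-energy bandlimited signal plus a constant). Fix a sampling period $T>0$. For $\Delta\in\mathbb R$ the fractional translation is $\tau_\Delta(x)[n]=z(nT+\Delta)$, where $z$ is the $\frac1{2T}$-bandlimited function with $z(nT)=x[n]$ for all $n\in\mathbb Z$. If $x-c\in\ell^2(\mathbb Z)$ for a constant $c$, the DTFT of $x$ is $2\pi c\,\delta_0+U$, where $U(\theta)=\sum_n (x[n]-c)e^{-i\theta n}$ in $L^2(\mathbb R/2\pi\mathbb Z)$. Let $d\ge 0$ be an integer, let $\mathrm{Poly}_d(s)=\sum_{k=0}^d a_k s^k$ with arbitrary $a_0,\dots,a_d\in\mathbb C$, and put $I=\frac{d+1}{2}$. The alias-free polynomial activation $f$ maps a signal $x\in \ell^2(\mathbb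 Z)$ to the signal $y=f(x)$ computed as follows. 1. Upsample by $I$: $x_{\mathrm{up}}[m]=\sum_{n\in\mathbb Z}x[n]\operatorname{sinc}\left(\frac{m}{I}-n\right)$. 2. Apply the polynomial pointwise: $y_{\mathrm{poly}}[m]=\mathrm{Poly}_d(x_{\mathrm{up}}[m])$. 3. Apply the ideal low-pass filter with cutoff $\frac{2}{d+1}$: $y_{\mathrm{LPF}}$ is the signal whose DTFT is that of $y_{\mathrm{poly}}$ multiplied by the indicator function of $\{\theta\in[-\pi,\pi]: |\theta|<\frac{2\pi}{d+1}\}$. 4. Downsample by $I$: $y[n]=w(In)$, where $w$ is the $\frac12$-bandlimited function with $w(m)=y_{\mathrm{LPF}}[m]$ for all $m\in\mathbb Z$ (so $y[n]=y_{\mathrm{LPF}}[In]$ when $I$ is an integer). Proposition. The operator $f$ is shift-equivariant with respect to the continuous domain: for every $x\in \ell^2(\mathbb Z)$ and every $\Delta\in\mathbb R$, the signals $\tau_\Delta(x)\in\ell^2(\mathbb Z)$, $f(x)$, $f(\tau_\Delta(x))$ and $\tau_\Delta(f(x))$ are well defined (exist and are unique), and $$f(\tau_\Delta(x))=\tau_\Delta(f(x)).$$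 -/

import Mathlib

/-! Discrete signals are functions `ℤ → ℂ`, continuous-time signals are functions `ℝ → ℂ`.
Operators on discrete signals are given by their graphs: `F x y` says that `y` is an output of `F`
on the input `x`; `IsValueAt F x y` says that `F` is defined at `x`, with the single value `y`. -/

open MeasureTheory FourierTransform

namespace AliasFree

instance instFactTwoPiPos : Fact (0 < 2 * Real.pi) := ⟨Real.two_pi_pos⟩

/-- The operator with graph `F` is defined at `x`, and `y` is its one and only value there. -/
def IsValueAt (F : (ℤ → ℂ) → (ℤ → ℂ) → Prop) (x y : ℤ → ℂ) : Prop :=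
  ∀ v, F x v ↔ v = y

/-- `z` is band-limited to the frequencies `|ω| ≤ B` (in cycles per unit of time): up to an additive
constant (a component at frequency zero) it is the inverse Fourier transform
`t ↦ ∫ Z(ω) exp(2πiωt) dω` of a square-integrable `Z` that vanishes outside `[-B, B]`. -/
def IsBandlimited (B : ℝ) (z : ℝ → ℂ) : Prop :=
  ∃ (c : ℂ) (Z : ℝ → ℂ), MemLp Z 2 ∧ (∀ ω, B < |ω| → Z ω = 0) ∧ ∀ t, z t = c + 𝓕⁻ Z t

/-- `z` is a `1/(2T)`-band-limited continuous-time signal with samples `z (nT) = x[n]`. -/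
def IsInterpolant (T : ℝ) (x : ℤ → ℂ) (z : ℝ → ℂ) : Prop :=
  IsBandlimited (1 / (2 * T)) z ∧ ∀ n : ℤ, z (n * T) = x n

/-- The fractional translation `τ_Δ` of discrete signals, for the sampling period `T`:
`τ_Δ(x)[n] = z (nT + Δ)`, where `z` is the `1/(2T)`-band-limited signal with `z (nT) = x[n]`. -/
def FracTranslate (T Δ : ℝ) (x y : ℤ → ℂ) : Prop :=
  ∃ z, IsInterpolant T x z ∧ ∀ n : ℤ, y n = z (n * T + Δ)

/-- Ideal upsampling by the (possibly non-integer) factor `r`, by sinc interpolation: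
`y[m] = ∑ₙ x[n] sinc (m / r - n)` with the normalized `sinc s = sin (π s) / (π s)`. -/
def Upsample (r : ℝ) (x y : ℤ → ℂ) : Prop :=
  ∀ m : ℤ, HasSum (fun n : ℤ => x n * (Real.sinc (Real.pi * (m / r - n)) : ℂ)) (y m)

/-- The discrete-time Fourier transform of `x` is `2π c δ₀ + U`: here `c` is the constant component
of `x`, and `U(θ) = ∑ₙ (x[n] - c) exp(-iθn)` with convergence in `L²(ℝ / 2πℤ)`. -/
def HasDTFT (x : ℤ → ℂ) (c : ℂ)
    (U : Lp ℂ 2 (AddCircle.haarAddCircle (T := 2 * Real.pi))) : Prop :=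
  HasSum (fun n : ℤ => (x n - c) • fourierLp (T := 2 * Real.pi) 2 (-n)) U

/-- The ideal low-pass filter with cutoff ratio `κ > 0`: the transform of `x` is multiplied by
the indicator function of the frequencies `θ ∈ [-π, π]` with `|θ| < κ π`.
The norm of `θ : ℝ / 2πℤ` is the absolute value of its representative in `[-π, π]`;
the constant component, at `θ = 0`, passes. -/
def LowPass (κ : ℝ) (x y : ℤ → ℂ) : Prop :=
  ∃ (c : ℂ) (U V : Lp ℂ 2 (AddCircle.haarAddCircle (T := 2 * Real.pi))),
    HasDTFT x c U ∧ HasDTFT y c V ∧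
      V =ᵐ[AddCircle.haarAddCircle]
        Set.indicator {θ : AddCircle (2 * Real.pi) | ‖θ‖ < κ * Real.pi} U

/-- Downsampling by the (possibly non-integer) factor `r`: the band-limited signal represented by
`x` (at unit sampling period) is sampled again with period `r`.
For an integer `r` this is `y[n] = x[r n]`. -/
def Downsample (r : ℝ) (x y : ℤ → ℂ) : Prop :=
  ∃ z, IsInterpolant 1 x z ∧ ∀ n : ℤ, y n = z (r * n)

/-- The alias-free polynomial activation: upsample by `(d + 1) / 2`, apply the polynomial `p`
pointwise, apply the ideal low-pass filter with cutoff `2 / (d + 1)`, downsample by `(d + 1) / 2`. -/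
def AliasFreePoly (d : ℕ) (p : Polynomial ℂ) (x y : ℤ → ℂ) : Prop :=
  ∃ xUp yLPF : ℤ → ℂ,
    Upsample (((d : ℝ) + 1) / 2) x xUp ∧
    LowPass (2 / ((d : ℝ) + 1)) (fun m => p.eval (xUp m)) yLPF ∧
    Downsample (((d : ℝ) + 1) / 2) yLPF y

/-- Shift-equivariance with respect to the continuous domain: `F (τ_Δ x) = τ_Δ (F x)` for every
square-summable `x` and every real `Δ`. Below, `x' = τ_Δ x`, `y = F x` and
`w = F (τ_Δ x) = τ_Δ (F x)`; all four are required to be well defined. -/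
def ShiftEquivariant (T : ℝ) (F : (ℤ → ℂ) → (ℤ → ℂ) → Prop) : Prop :=
  ∀ x : ℤ → ℂ, Memℓp x 2 → ∀ Δ : ℝ, ∃ x' y w : ℤ → ℂ,
    Memℓp x' 2 ∧ IsValueAt (FracTranslate T Δ) x x' ∧ IsValueAt F x y ∧
      IsValueAt F x' w ∧ IsValueAt (FracTranslate T Δ) y w

end AliasFree

namespace AliasFree

/-! Up to a constant, every signal involved is the sequence of integer samples of some `𝓕⁻ Z` with
`Z` square-integrable on a bounded band, and each operation acts on `Z`: translation is modulation,
resampling is dilation, and a polynomial of degree at most `d` enlarges the band by a factor `d` and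
adds a constant.

In cycles per upsampled sample, the polynomial's output has band `d/(d+1)`. For `d > 1` this exceeds
the Nyquist frequency `1/2`, so sampling does alias; but the aliases only reach frequencies of size
at least `1 - d/(d+1) = 1/(d+1)`, exactly the cutoff. Hence the discrete filter cuts off the
continuous spectrum as if there were no aliasing (`lowPass_fourierInv`), and the activation is a
continuous-time operation (`BandSpectrum.isValueAt_aliasFreePoly`). Cutting off commutes with
modulation and a pointwise polynomial commutes with translation, which gives equivariance.
Single-valuedness rests on `HasDTFT.unique` and `IsInterpolant.unique`. -/

/-! ### Band-limited spectra: linearity, dilation, modulation -/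

/-- `Z` is a square-integrable function that vanishes outside `[-b, b]`. -/
structure BandSpectrum (b : ℝ) (Z : ℝ → ℂ) : Prop where
  memLp : MemLp Z 2
  eq_zero : ∀ ω, b < |ω| → Z ω = 0

theorem fourierInv_apply (Z : ℝ → ℂ) (t : ℝ) :
    𝓕⁻ Z t = ∫ ω : ℝ, Complex.exp (2 * Real.pi * Complex.I * ω * t) * Z ω := by
  rw [Real.fourierInv_eq']
  congr 1
  ext ω
  rw [smul_eq_mul]
  congr 2
  simp
  ring

theorem norm_exp_frequency (ω t : ℝ) :
    ‖Complex.exp (2 * Real.pi * Complex.I * ω * t)‖ = 1 := by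
  rw [show (2 * Real.pi * Complex.I * ω * t : ℂ) = ((2 * Real.pi * ω * t : ℝ) : ℂ) * Complex.I by
    push_cast; ring, Complex.norm_exp_ofReal_mul_I]

theorem memLp_comp_div {Z : ℝ → ℂ} (hZ : MemLp Z 2) {r : ℝ} (hr : r ≠ 0) :
    MemLp (fun ω => Z (ω / r)) 2 := by
  have hm : AEStronglyMeasurable (fun ω => Z (ω / r)) := by
    refine hZ.1.comp_quasiMeasurePreserving ⟨by fun_prop, ?_⟩
    simp_rw [div_eq_mul_inv]
    rw [Real.map_volume_mul_right (inv_ne_zero hr)]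
    exact Measure.smul_absolutelyContinuous
  rw [memLp_two_iff_integrable_sq_norm hm]
  exact ((memLp_two_iff_integrable_sq_norm hZ.1).1 hZ).comp_div hr

namespace BandSpectrum

variable {a b : ℝ} {Z W : ℝ → ℂ}

/-- On a set of finite measure L² is contained in L¹. This makes `𝓕⁻ Z t` a convergent integral at
every `t`, not just an L² class. -/
theorem integrable (h : BandSpectrum b Z) : Integrable Z := by
  have h1 : IntegrableOn Z (Set.Icc (-b) b) :=
    (h.memLp.restrict (Set.Icc (-b) b)).integrable (by norm_num)
  refine (integrableOn_iff_integrable_of_support_subset fun ω hω => ?_).1 h1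
  by_contra hn
  refine hω (h.eq_zero ω ?_)
  by_contra! hle
  exact hn (abs_le.1 hle)

theorem integrable_exp_mul (h : BandSpectrum b Z) (t : ℝ) :
    Integrable fun ω : ℝ => Complex.exp (2 * Real.pi * Complex.I * ω * t) * Z ω :=
  h.integrable.bdd_mul (c := 1) (by fun_prop)
    (Filter.Eventually.of_forall fun ω => (norm_exp_frequency ω t).le)

theorem zero (b : ℝ) : BandSpectrum b 0 := ⟨MemLp.zero, fun _ _ => rfl⟩

theorem mono (h : BandSpectrum a Z) (hab : a ≤ b) : BandSpectrum b Z :=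
  ⟨h.memLp, fun ω hω => h.eq_zero ω (hab.trans_lt hω)⟩

theorem add (hZ : BandSpectrum b Z) (hW : BandSpectrum b W) : BandSpectrum b (Z + W) :=
  ⟨hZ.memLp.add hW.memLp, fun ω hω => by simp [hZ.eq_zero ω hω, hW.eq_zero ω hω]⟩

theorem const_smul (h : BandSpectrum b Z) (c : ℂ) : BandSpectrum b (c • Z) :=
  ⟨h.memLp.const_smul c, fun ω hω => by simp [h.eq_zero ω hω]⟩

theorem indicator (h : BandSpectrum b Z) {S : Set ℝ} (hS : MeasurableSet S)
    (hSa : ∀ ω ∈ S, |ω| ≤ b → |ω| ≤ a) : BandSpectrum a (S.indicator Z) := by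
  refine ⟨h.memLp.indicator hS, fun ω hω => ?_⟩
  by_cases hωS : ω ∈ S
  · rw [Set.indicator_of_mem hωS]
    refine h.eq_zero ω ?_
    by_contra! hn
    exact absurd (hSa ω hωS hn) (not_le.2 hω)
  · exact Set.indicator_of_notMem hωS _

theorem fourierInv_add (hZ : BandSpectrum a Z) (hW : BandSpectrum b W) (t : ℝ) :
    𝓕⁻ (Z + W) t = 𝓕⁻ Z t + 𝓕⁻ W t := by
  simp only [fourierInv_apply, Pi.add_apply, mul_add]
  exact integral_add (hZ.integrable_exp_mul t) (hW.integrable_exp_mul t)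

end BandSpectrum

theorem fourierInv_const_smul (c : ℂ) (Z : ℝ → ℂ) (t : ℝ) : 𝓕⁻ (c • Z) t = c * 𝓕⁻ Z t := by
  simp only [fourierInv_apply, Pi.smul_apply, smul_eq_mul, ← integral_const_mul]
  congr 1
  ext ω
  ring

theorem fourierInv_zero_apply (t : ℝ) : 𝓕⁻ (0 : ℝ → ℂ) t = 0 := by
  simp [fourierInv_apply]

/-- The spectrum of `t ↦ z (r t)`, for `z` with spectrum `Z`. -/
noncomputable def dilate (r : ℝ) (Z : ℝ → ℂ) : ℝ → ℂ :=
  fun ω => (r : ℂ)⁻¹ * Z (ω / r)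

theorem fourierInv_dilate {r : ℝ} (hr : 0 < r) (Z : ℝ → ℂ) (t : ℝ) :
    𝓕⁻ (dilate r Z) t = 𝓕⁻ Z (r * t) := by
  have hr' : (r : ℂ) ≠ 0 := by exact_mod_cast hr.ne'
  have h := Measure.integral_comp_div
    (fun ω : ℝ => (r : ℂ)⁻¹ * (Complex.exp (2 * Real.pi * Complex.I * ω * (r * t : ℝ)) * Z ω)) r
  rw [integral_const_mul _ fun ω : ℝ => Complex.exp _ * Z ω, ← fourierInv_apply, abs_of_pos hr,
    Complex.real_smul, mul_inv_cancel_left₀ hr'] at h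
  rw [← h, fourierInv_apply]
  congr 1
  ext ω
  have : (2 * Real.pi * Complex.I * (ω / r : ℝ) * (r * t : ℝ) : ℂ)
      = 2 * Real.pi * Complex.I * ω * t := by
    push_cast
    field_simp
  rw [this, dilate]
  ring

theorem BandSpectrum.dilate {b r : ℝ} {Z : ℝ → ℂ} (h : BandSpectrum b Z) (hr : 0 < r) :
    BandSpectrum (b * r) (dilate r Z) := by
  refine ⟨(memLp_comp_div h.memLp hr.ne').const_mul _, fun ω hω => ?_⟩
  have : Z (ω / r) = 0 := by
    refine h.eq_zero _ ?_
    rw [abs_div, abs_of_pos hr]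
    exact (lt_div_iff₀ hr).2 hω
  simp [AliasFree.dilate, this]

/-- The spectrum of `t ↦ z (t + s)`, for `z` with spectrum `Z`. -/
noncomputable def modulate (s : ℝ) (Z : ℝ → ℂ) : ℝ → ℂ :=
  fun ω => Complex.exp (2 * Real.pi * Complex.I * ω * s) * Z ω

theorem fourierInv_modulate (s : ℝ) (Z : ℝ → ℂ) (t : ℝ) :
    𝓕⁻ (modulate s Z) t = 𝓕⁻ Z (t + s) := by
  simp only [fourierInv_apply, modulate]
  congr 1
  ext ω
  rw [← mul_assoc, ← Complex.exp_add]
  congr 2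
  push_cast
  ring

theorem BandSpectrum.modulate {b : ℝ} {Z : ℝ → ℂ} (h : BandSpectrum b Z) (s : ℝ) :
    BandSpectrum b (modulate s Z) := by
  refine ⟨?_, fun ω hω => by simp [AliasFree.modulate, h.eq_zero ω hω]⟩
  refine MemLp.of_le h.memLp (AEStronglyMeasurable.mul (by fun_prop) h.memLp.1)
    (Filter.Eventually.of_forall fun ω => ?_)
  rw [AliasFree.modulate, norm_mul, norm_exp_frequency, one_mul]

/-- Filtering and translation are both multiplications in frequency, so they commute. -/
theorem indicator_modulate (S : Set ℝ) (s : ℝ) (Z : ℝ → ℂ) :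
    S.indicator (modulate s Z) = modulate s (S.indicator Z) := by
  ext ω
  by_cases h : ω ∈ S <;> simp [modulate, h]

/-! ### Products and polynomials of band-limited signals -/

/-- The product of two band-limited signals is band-limited: its spectrum is the convolution. -/
theorem BandSpectrum.exists_mul {a b : ℝ} {Z W : ℝ → ℂ} (hZ : BandSpectrum a Z)
    (hW : BandSpectrum b W) :
    ∃ V, BandSpectrum (a + b) V ∧ ∀ t, 𝓕⁻ V t = 𝓕⁻ Z t * 𝓕⁻ W t := by
  set V : ℝ → ℂ := convolution Z W (ContinuousLinearMap.mul ℂ ℂ) volume with hV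
  have hVi : Integrable V := hZ.integrable.integrable_convolution _ hW.integrable
  have hZ2 := (memLp_two_iff_integrable_sq_norm hZ.memLp.1).1 hZ.memLp
  have hW2 := (memLp_two_iff_integrable_sq_norm hW.memLp.1).1 hW.memLp
  -- The bound `uv ≤ u² + v²` under the integral makes the convolution bounded; being also
  -- integrable, it is square-integrable.
  have hbd : ∀ ω, ‖V ω‖ ≤ (∫ s, ‖Z s‖ ^ 2) + ∫ s, ‖W s‖ ^ 2 := by
    intro ω
    have hW2' : Integrable fun s => ‖W (ω - s)‖ ^ 2 := hW2.comp_sub_left ω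
    rw [← integral_sub_left_eq_self (fun s => ‖W s‖ ^ 2) volume ω, ← integral_add hZ2 hW2']
    refine norm_integral_le_of_norm_le (hZ2.add hW2') (Filter.Eventually.of_forall fun s => ?_)
    simp only [ContinuousLinearMap.mul_apply', norm_mul]
    nlinarith [sq_nonneg (‖Z s‖ - ‖W (ω - s)‖), sq_nonneg (‖Z s‖ + ‖W (ω - s)‖)]
  refine ⟨V, ⟨?_, fun ω hω => ?_⟩, fun t => ?_⟩
  · rw [memLp_two_iff_integrable_sq_norm hVi.1]
    refine (hVi.norm.const_mul ((∫ s, ‖Z s‖ ^ 2) + ∫ s, ‖W s‖ ^ 2)).mono'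
      (hVi.1.norm.pow 2) (Filter.Eventually.of_forall fun ω => ?_)
    rw [Real.norm_of_nonneg (by positivity), sq]
    exact mul_le_mul_of_nonneg_right (hbd ω) (norm_nonneg _)
  · rw [hV, convolution_def]
    refine integral_eq_zero_of_ae (Filter.Eventually.of_forall fun s => ?_)
    simp only [ContinuousLinearMap.mul_apply', Pi.zero_apply, mul_eq_zero]
    by_contra! hn
    have h1 : |s| ≤ a := by
      by_contra! h
      exact hn.1 (hZ.eq_zero _ h)
    have h2 : |ω - s| ≤ b := by
      by_contra! h
      exact hn.2 (hW.eq_zero _ h)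
    have := abs_add_le s (ω - s)
    rw [add_sub_cancel] at this
    linarith
  · simp only [Real.fourierInv_eq_fourier_neg]
    exact Real.fourier_mul_convolution_eq hZ.integrable hW.integrable (-t)

/-- A polynomial of degree at most `d` multiplies the bandwidth by at most `d`. -/
theorem BandSpectrum.exists_polynomial {b : ℝ} {Z : ℝ → ℂ} (hb : 0 ≤ b) (hZ : BandSpectrum b Z)
    (d : ℕ) (p : Polynomial ℂ) (hp : p.natDegree ≤ d) :
    ∃ (c : ℂ) (G : ℝ → ℂ), BandSpectrum (d * b) G ∧ ∀ t, p.eval (𝓕⁻ Z t) = c + 𝓕⁻ G t := by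
  induction d generalizing p with
  | zero =>
    refine ⟨p.coeff 0, 0, BandSpectrum.zero _, fun t => ?_⟩
    rw [Polynomial.eq_C_of_natDegree_le_zero hp]
    simp [fourierInv_zero_apply]
  | succ d ih =>
    -- Horner's rule: the constant `c` of the quotient, once multiplied by the signal, contributes
    -- `c • Z` to the spectrum.
    obtain ⟨c, G, hG, h⟩ := ih p.divX
      (by rw [Polynomial.natDegree_divX_eq_natDegree_tsub_one]; omega)
    obtain ⟨V, hV, hVm⟩ := hZ.exists_mul hG
    have hdb : 0 ≤ d * b := by positivity
    have hs : ((d + 1 : ℕ) : ℝ) * b = b + d * b := by push_cast; ring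
    rw [hs]
    have hZ' : BandSpectrum (b + d * b) (c • Z) := (hZ.mono (by linarith)).const_smul c
    refine ⟨p.coeff 0, c • Z + V, hZ'.add hV, fun t => ?_⟩
    rw [hZ'.fourierInv_add hV, fourierInv_const_smul, hVm]
    conv_lhs => rw [← Polynomial.divX_mul_X_add p]
    simp only [Polynomial.eval_add, Polynomial.eval_mul, Polynomial.eval_X, Polynomial.eval_C, h]
    ring


/-! ### Wrapping spectra around the circle; Fourier coefficients and Parseval -/

/-- The function on the circle of length `2π` that takes the value `Z ω` at the class of `2πω`,
for `ω ∈ (a, a + 1]`. -/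
noncomputable def circleLift (a : ℝ) (Z : ℝ → ℂ) : AddCircle (2 * Real.pi) → ℂ :=
  AddCircle.liftIoc (2 * Real.pi) (2 * Real.pi * a) fun θ => Z (θ / (2 * Real.pi))

theorem exists_coe_eq (a : ℝ) (θ : AddCircle (2 * Real.pi)) :
    ∃ ω ∈ Set.Ioc a (a + 1), ((2 * Real.pi * ω : ℝ) : AddCircle (2 * Real.pi)) = θ := by
  have hpi := Real.two_pi_pos
  obtain ⟨t, ht, rfl⟩ : θ ∈ ((↑) : ℝ → AddCircle (2 * Real.pi)) ''
      Set.Ioc (2 * Real.pi * a) (2 * Real.pi * a + 2 * Real.pi) := by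
    rw [AddCircle.coe_image_Ioc_eq]; trivial
  refine ⟨t / (2 * Real.pi), ⟨?_, ?_⟩, ?_⟩
  · rw [lt_div_iff₀ hpi]; linarith [ht.1]
  · rw [div_le_iff₀ hpi]; linarith [ht.2]
  · rw [mul_div_cancel₀ _ hpi.ne']

theorem circleLift_coe {a ω : ℝ} (hω : ω ∈ Set.Ioc a (a + 1)) (Z : ℝ → ℂ) :
    circleLift a Z ((2 * Real.pi * ω : ℝ) : AddCircle (2 * Real.pi)) = Z ω := by
  have hpi := Real.two_pi_pos
  rw [circleLift, AddCircle.liftIoc_coe_apply, mul_div_cancel_left₀ _ hpi.ne']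
  exact ⟨by nlinarith [hω.1], by nlinarith [hω.2]⟩

theorem integral_circleLift {a : ℝ} {Z : ℝ → ℂ}
    (hZ : ∀ᵐ ω, ω ∉ Set.Ioc a (a + 1) → Z ω = 0) :
    ∫ θ, circleLift a Z θ ∂AddCircle.haarAddCircle = ∫ ω, Z ω := by
  have hpi := Real.two_pi_pos
  have h1 : 2 * Real.pi * a / (2 * Real.pi) = a := by field_simp
  have h2 : (2 * Real.pi * a + 2 * Real.pi) / (2 * Real.pi) = a + 1 := by field_simp
  rw [AddCircle.integral_haarAddCircle, circleLift, AddCircle.integral_liftIoc_eq_intervalIntegral,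
    intervalIntegral.integral_comp_div _ hpi.ne', inv_smul_smul₀ hpi.ne', h1, h2,
    intervalIntegral.integral_of_le (by linarith)]
  exact setIntegral_eq_integral_of_ae_compl_eq_zero hZ

theorem memLp_circleLift {Z : ℝ → ℂ} (hZ : MemLp Z 2) (a : ℝ) :
    MemLp (circleLift a Z) 2 AddCircle.haarAddCircle :=
   MemLp.haarAddCircle
    (MemLp.memLp_liftIoc (MemLp.restrict _ (memLp_comp_div hZ Real.two_pi_pos.ne')))

/-- Substitute `θ = 2πω`. The index is `-n` because the DTFT pairs `x[n]` with `exp(-iθn)`. The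
window is left free so that alias bands can be wrapped as well. -/
theorem fourierCoeff_circleLift {a : ℝ} {Z : ℝ → ℂ}
    (hZ : ∀ᵐ ω, ω ∉ Set.Ioc a (a + 1) → Z ω = 0) (n : ℤ) :
    fourierCoeff (circleLift a Z) (-n) = 𝓕⁻ Z n := by
  have h : ∀ θ, fourier (- -n) θ • circleLift a Z θ
      = circleLift a (fun ω => Complex.exp (2 * Real.pi * Complex.I * ω * (n : ℝ)) * Z ω) θ := by
    intro θ
    obtain ⟨ω, hω, rfl⟩ := exists_coe_eq a θ
    rw [circleLift_coe hω, circleLift_coe hω, fourier_coe_apply, smul_eq_mul]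
    congr 2
    have : (Real.pi : ℂ) ≠ 0 := by exact_mod_cast Real.pi_ne_zero
    push_cast
    field_simp
  rw [fourierCoeff, integral_congr_ae (Filter.Eventually.of_forall h), integral_circleLift,
    fourierInv_apply]
  filter_upwards [hZ] with ω hω hn
  rw [hω hn, mul_zero]

theorem hasSum_circleLift {a : ℝ} {Z : ℝ → ℂ} (hZ2 : MemLp Z 2)
    (hZ : ∀ᵐ ω, ω ∉ Set.Ioc a (a + 1) → Z ω = 0) :
    HasSum (fun n : ℤ => 𝓕⁻ Z n • fourierLp (T := 2 * Real.pi) 2 (-n))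
      (memLp_circleLift hZ2 a).toLp := by
  have h := hasSum_fourier_series_L2 (memLp_circleLift hZ2 a).toLp
  rw [← (Equiv.neg ℤ).hasSum_iff] at h
  convert! h using 1
  ext1 n
  simp only [Function.comp_apply, Equiv.neg_apply]
  rw [fourierCoeff_congr_ae (memLp_circleLift hZ2 a).coeFn_toLp, fourierCoeff_circleLift hZ]

theorem repr_circleLift {a : ℝ} {Z : ℝ → ℂ} (hZ2 : MemLp Z 2)
    (hZ : ∀ᵐ ω, ω ∉ Set.Ioc a (a + 1) → Z ω = 0) (n : ℤ) :
    fourierBasis.repr (memLp_circleLift hZ2 a).toLp (-n) = 𝓕⁻ Z n := by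
  rw [fourierBasis_repr, fourierCoeff_congr_ae (memLp_circleLift hZ2 a).coeFn_toLp,
    fourierCoeff_circleLift hZ]

/-- Parseval's identity for square-integrable spectra supported in an interval of length one. -/
theorem hasSum_fourierInv_mul {a : ℝ} {Z W : ℝ → ℂ} (hZ2 : MemLp Z 2)
    (hZ : ∀ᵐ ω, ω ∉ Set.Ioc a (a + 1) → Z ω = 0) (hW2 : MemLp W 2)
    (hW : ∀ᵐ ω, ω ∉ Set.Ioc a (a + 1) → W ω = 0) :
    HasSum (fun n : ℤ => 𝓕⁻ Z n * star (𝓕⁻ W n)) (∫ ω, Z ω * star (W ω)) := by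
  have h := (fourierBasis (T := 2 * Real.pi)).hasSum_inner_mul_inner
    (memLp_circleLift hW2 a).toLp (memLp_circleLift hZ2 a).toLp
  rw [← (Equiv.neg ℤ).hasSum_iff] at h
  convert! h using 1
  · ext1 n
    simp only [Function.comp_apply, Equiv.neg_apply]
    rw [← inner_conj_symm, ← HilbertBasis.repr_apply_apply, ← HilbertBasis.repr_apply_apply,
      repr_circleLift hZ2 hZ, repr_circleLift hW2 hW, mul_comm]
    rfl
  · rw [L2.inner_def, ← integral_circleLift (a := a)
      (by filter_upwards [hZ] with ω hω hn; rw [hω hn, zero_mul])]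
    refine integral_congr_ae ?_
    filter_upwards [(memLp_circleLift hW2 a).coeFn_toLp, (memLp_circleLift hZ2 a).coeFn_toLp]
      with θ h1 h2
    rw [h1, h2]
    obtain ⟨ω, hω, rfl⟩ := exists_coe_eq a θ
    simp only [circleLift_coe hω]
    rfl

/-! ### Sinc interpolation and spectra of square-summable signals -/

/-- The spectrum of the sinc kernel. -/
noncomputable def box : ℝ → ℂ := (Set.Icc (-(1 / 2)) (1 / 2)).indicator 1

theorem bandSpectrum_box : BandSpectrum (1 / 2) box := by
  refine ⟨memLp_indicator_const 2 measurableSet_Icc (1 : ℂ) (Or.inr (by simp)), fun ω hω => ?_⟩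
  refine Set.indicator_of_notMem (fun h => ?_) _
  exact absurd (abs_le.2 h) (not_le.2 hω)

theorem fourierInv_box (t : ℝ) : 𝓕⁻ box t = (Real.sinc (Real.pi * t) : ℂ) := by
  have h : ∀ ω : ℝ, Complex.exp (2 * Real.pi * Complex.I * ω * t) * box ω
      = (Set.Icc (-(1 / 2)) (1 / 2)).indicator
        (fun ω : ℝ => Complex.exp (2 * Real.pi * Complex.I * ω * t)) ω := by
    intro ω
    by_cases hω : ω ∈ Set.Icc (-(1 / 2) : ℝ) (1 / 2) <;>
      simp only [box, hω, Set.indicator_of_mem, Set.indicator_of_notMem, Pi.one_apply, mul_one,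
        mul_zero, not_false_eq_true]
  rw [fourierInv_apply]
  simp_rw [h]
  rw [integral_indicator measurableSet_Icc, integral_Icc_eq_integral_Ioc,
    ← intervalIntegral.integral_of_le (by norm_num)]
  rcases eq_or_ne t 0 with rfl | ht
  · norm_num
  have hc : 2 * Real.pi * t ≠ 0 := by positivity
  have h2 := intervalIntegral.integral_comp_mul_left (a := -(1 / 2)) (b := 1 / 2)
    (fun s : ℝ => Complex.exp (s * Complex.I)) hc
  rw [show 2 * Real.pi * t * -(1 / 2) = -(Real.pi * t) by ring,
    show 2 * Real.pi * t * (1 / 2) = Real.pi * t by ring, integral_exp_mul_I_eq_sinc] at h2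
  calc _ = ∫ ω in (-(1 / 2) : ℝ)..1 / 2, Complex.exp ((2 * Real.pi * t * ω : ℝ) * Complex.I) := by
        congr 1; ext ω; congr 1; push_cast; ring
    _ = _ := by
        rw [h2, Complex.real_smul]
        have h3 : (Real.pi : ℂ) ≠ 0 := by exact_mod_cast Real.pi_ne_zero
        have h4 : (t : ℂ) ≠ 0 := by exact_mod_cast ht
        push_cast
        field_simp

/-- The closed band exceeds the half-open window only by the endpoint `-1/2`, a null set. -/
theorem BandSpectrum.ae_notMem_Ioc {Z : ℝ → ℂ} (h : BandSpectrum (1 / 2) Z) :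
    ∀ᵐ ω, ω ∉ Set.Ioc (-(1 / 2) : ℝ) (-(1 / 2) + 1) → Z ω = 0 := by
  have : ∀ᵐ ω : ℝ, ω ≠ -(1 / 2) := by simp [ae_iff]
  filter_upwards [this] with ω hne hn
  refine h.eq_zero ω ?_
  by_contra! hle
  have := abs_le.1 hle
  exact hn ⟨lt_of_le_of_ne this.1 hne.symm, by linarith [this.2]⟩

/-- Sinc interpolation of band-limited signals of finite energy. -/
theorem BandSpectrum.hasSum_sinc {Z : ℝ → ℂ} (h : BandSpectrum (1 / 2) Z) (t : ℝ) :
    HasSum (fun n : ℤ => 𝓕⁻ Z n * (Real.sinc (Real.pi * (t - n)) : ℂ)) (𝓕⁻ Z t) := by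
  -- Parseval against the spectrum of the sinc kernel centred at `t`; its conjugate is `exp(2πiωt)`
  -- on the band.
  have hW := bandSpectrum_box.modulate (-t)
  convert! hasSum_fourierInv_mul h.memLp h.ae_notMem_Ioc hW.memLp hW.ae_notMem_Ioc using 1
  · ext n
    rw [fourierInv_modulate, fourierInv_box, ← Real.sinc_neg]
    congr 1
    rw [Complex.star_def, Complex.conj_ofReal]
    congr 2
    ring
  · rw [fourierInv_apply]
    congr 1
    ext ω
    by_cases hω : |ω| ≤ 1 / 2
    · have hb : box ω = 1 := Set.indicator_of_mem (Set.mem_Icc.2 (abs_le.1 hω)) _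
      rw [AliasFree.modulate, hb, mul_one, Complex.star_def, ← Complex.exp_conj, mul_comm]
      congr 2
      simp [Complex.conj_ofNat]
    · rw [h.eq_zero ω (not_le.1 hω), mul_zero, zero_mul]

/-- Every square-summable signal consists of the samples of a band-limited signal. -/
theorem exists_bandSpectrum {x : ℤ → ℂ} (hx : Memℓp x 2) :
    ∃ Z, BandSpectrum (1 / 2) Z ∧ ∀ n : ℤ, 𝓕⁻ Z n = x n := by
  have hpi := Real.two_pi_pos
  have hx' : Memℓp (fun n => x (-n)) 2 := by
    rw [memℓp_gen_iff (by norm_num)] at hx ⊢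
    exact (Equiv.neg ℤ).summable_iff.2 hx
  set U := (fourierBasis (T := 2 * Real.pi)).repr.symm ⟨_, hx'⟩ with hU
  set Z : ℝ → ℂ := (Set.Ioc (-(1 / 2)) (1 / 2)).indicator
    (fun ω => U ((2 * Real.pi * ω : ℝ) : AddCircle (2 * Real.pi))) with hZ
  have hZ2 : MemLp Z 2 := by
    have h1 := (Lp.memLp U).of_haarAddCircle.comp_measurePreserving
      (AddCircle.measurePreserving_mk (2 * Real.pi) (-Real.pi))
    rw [← memLp_indicator_iff_restrict measurableSet_Ioc] at h1
    convert! memLp_comp_div h1 (inv_ne_zero hpi.ne') using 1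
    ext ω
    rw [hZ, div_inv_eq_mul, mul_comm ω]
    have : 2 * Real.pi * ω ∈ Set.Ioc (-Real.pi) (-Real.pi + 2 * Real.pi)
        ↔ ω ∈ Set.Ioc (-(1 / 2) : ℝ) (1 / 2) := by
      have := Real.pi_pos
      constructor
      · rintro ⟨h1, h2⟩
        constructor <;> nlinarith
      · rintro ⟨h1, h2⟩
        constructor <;> nlinarith
    simp only [Set.indicator, this, Function.comp_apply]
  have hZb : BandSpectrum (1 / 2) Z := by
    refine ⟨hZ2, fun ω hω => Set.indicator_of_notMem (fun h => ?_) _⟩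
    exact absurd (abs_le.2 ⟨h.1.le, h.2⟩) (not_le.2 hω)
  refine ⟨Z, hZb, fun n => ?_⟩
  have hlift : circleLift (-(1 / 2)) Z = U := by
    ext θ
    obtain ⟨ω, hω, rfl⟩ := exists_coe_eq (-(1 / 2)) θ
    rw [circleLift_coe hω, hZ, Set.indicator_of_mem (Set.mem_Ioc.2 ⟨hω.1, by linarith [hω.2]⟩)]
  rw [← fourierCoeff_circleLift hZb.ae_notMem_Ioc, hlift, ← fourierBasis_repr, hU,
    LinearIsometryEquiv.apply_symm_apply]
  simp

/-! ### Uniqueness of the DTFT -/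

/-- The samples are the Fourier coefficients of the DTFT. -/
theorem HasDTFT.coeff {x : ℤ → ℂ} {c : ℂ}
    {U : Lp ℂ 2 (AddCircle.haarAddCircle (T := 2 * Real.pi))} (h : HasDTFT x c U) (n : ℤ) :
    fourierBasis.repr U (-n) = x n - c := by
  rw [HilbertBasis.repr_apply_apply]
  have h1 := h.mapL (innerSL ℂ (fourierBasis (T := 2 * Real.pi) (-n)))
  refine h1.unique ?_
  have := hasSum_single 
    (f := fun m => innerSL ℂ (fourierBasis (T := 2 * Real.pi) (-n))
      ((x m - c) • fourierLp (T := 2 * Real.pi) 2 (-m))) n ?_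
  · convert! this using 1
    simp [innerSL_apply_apply, orthonormal_fourier.1]
  · intro m hm
    simp [innerSL_apply_apply]
    right
    exact orthonormal_fourier.2 (by simpa using hm.symm)

theorem HasDTFT.memℓp {x : ℤ → ℂ} {c : ℂ}
    {U : Lp ℂ 2 (AddCircle.haarAddCircle (T := 2 * Real.pi))} (h : HasDTFT x c U) :
    Memℓp (fun n => x n - c) 2 := by
  have h1 := lp.memℓp (fourierBasis.repr U)
  rw [memℓp_gen_iff (by norm_num)] at h1 ⊢
  refine ((Equiv.neg ℤ).summable_iff.2 h1).congr fun n => ?_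
  rw [← h.coeff n]
  rfl

/-- A square-summable `x - c` tends to zero, so the constant component is determined as the limit of
`x`. -/
theorem HasDTFT.tendsto {x : ℤ → ℂ} {c : ℂ}
    {U : Lp ℂ 2 (AddCircle.haarAddCircle (T := 2 * Real.pi))} (h : HasDTFT x c U) :
    Filter.Tendsto x Filter.cofinite (nhds c) := by
  have h1 := h.memℓp
  rw [memℓp_gen_iff (by norm_num)] at h1
  have h2 := h1.tendsto_cofinite_zero
  rw [tendsto_iff_norm_sub_tendsto_zero]
  have h3 := h2.rpow_const (p := 1 / 2) (Or.inr (by norm_num))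
  refine (h3.congr fun n => ?_).trans (by norm_num)
  rw [← Real.rpow_mul (norm_nonneg _)]
  norm_num

/-- The constant component and the square-integrable part of the DTFT are unique. -/
theorem HasDTFT.unique {x : ℤ → ℂ} {c c' : ℂ}
    {U U' : Lp ℂ 2 (AddCircle.haarAddCircle (T := 2 * Real.pi))} (h : HasDTFT x c U)
    (h' : HasDTFT x c' U') : c = c' ∧ U = U' := by
  obtain rfl : c = c' := tendsto_nhds_unique h.tendsto h'.tendsto
  exact ⟨rfl, HasSum.unique h h'⟩

theorem HasDTFT.signal_unique {x y : ℤ → ℂ} {c : ℂ}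
    {U : Lp ℂ 2 (AddCircle.haarAddCircle (T := 2 * Real.pi))} (h : HasDTFT x c U)
    (h' : HasDTFT y c U) : x = y := by
  ext n
  exact sub_left_injective ((h.coeff n).symm.trans (h'.coeff n))


/-! ### Aliasing and the low-pass filter -/

theorem norm_coe_two_pi_mul {ω : ℝ} (hω : |ω| ≤ 1 / 2) :
    ‖((2 * Real.pi * ω : ℝ) : AddCircle (2 * Real.pi))‖ = 2 * Real.pi * |ω| := by
  have hpi := Real.two_pi_pos
  have h : |2 * Real.pi * ω| = 2 * Real.pi * |ω| := by rw [abs_mul, abs_of_pos hpi]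
  rw [(AddCircle.norm_coe_eq_abs_iff _ hpi.ne').2 _, h]
  rw [h, abs_of_pos hpi]
  nlinarith

/-- The distance from `ω` to the nearest integer is at least `r`: an aliased frequency stays out of
the passband. -/
theorem le_norm_coe_two_pi_mul {r ω : ℝ} (h1 : r ≤ ω) (h2 : ω ≤ 1 - r) (hr : 0 < r) :
    2 * Real.pi * r ≤ ‖((2 * Real.pi * ω : ℝ) : AddCircle (2 * Real.pi))‖ := by
  have hpi := Real.two_pi_pos
  rcases le_total ω (1 / 2) with h | h
  · rw [norm_coe_two_pi_mul (abs_le.2 ⟨by linarith, h⟩), abs_of_pos (by linarith)]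
    nlinarith
  · have : ((2 * Real.pi * ω : ℝ) : AddCircle (2 * Real.pi))
        = ((2 * Real.pi * (ω - 1) : ℝ) : AddCircle (2 * Real.pi)) := by
      rw [mul_sub, mul_one, AddCircle.coe_sub, AddCircle.coe_period, sub_zero]
    rw [this, norm_coe_two_pi_mul (abs_le.2 ⟨by linarith, by linarith⟩), abs_of_neg (by linarith)]
    nlinarith

theorem BandSpectrum.exists_hasDTFT {Z : ℝ → ℂ} (hZ : BandSpectrum (1 / 2) Z) (c : ℂ) :
    ∃ U, HasDTFT (fun n => c + 𝓕⁻ Z n) c U := by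
  refine ⟨_, (hasSum_circleLift hZ.memLp hZ.ae_notMem_Ioc).congr_fun ?_⟩
  simp

/-- If the frequencies of a signal that alias under sampling are all at least `κ / 2`, the low-pass
filter acts on the samples as it does on the signal. -/
theorem lowPass_fourierInv {κ : ℝ} (hκ : 0 < κ) {G : ℝ → ℂ} (hG : BandSpectrum (1 - κ / 2) G)
    (c : ℂ) : LowPass κ (fun n => c + 𝓕⁻ G n)
      (fun n => c + 𝓕⁻ ({ω : ℝ | |ω| < κ / 2}.indicator G) n) := by
  -- Passband and two outer bands. The supports fit in the unit windows at `-1/2`, `0` and `-1`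
  -- respectively (up to a null set), so each part wraps without overlapping itself and the DTFT of
  -- the samples is the sum of the three.
  set G₀ := {ω : ℝ | |ω| < κ / 2}.indicator G with hG₀
  set G₁ := {ω : ℝ | κ / 2 ≤ ω}.indicator G with hG₁
  set G₂ := {ω : ℝ | ω ≤ -(κ / 2)}.indicator G with hG₂
  have h₀ : BandSpectrum (1 / 2) G₀ :=
    hG.indicator (measurableSet_lt (by fun_prop) (by fun_prop)) fun ω h h' => by
      have : |ω| < κ / 2 := h
      -- Adding `|ω| < κ / 2` and `|ω| ≤ 1 - κ / 2` gives `2|ω| < 1`, even when `κ > 1` (the case `d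
      -- = 0`).
      linarith
  have h₁ : BandSpectrum (1 - κ / 2) G₁ :=
    hG.indicator (measurableSet_le (by fun_prop) (by fun_prop)) fun ω _ h' => h'
  have h₂ : BandSpectrum (1 - κ / 2) G₂ :=
    hG.indicator (measurableSet_le (by fun_prop) (by fun_prop)) fun ω _ h' => h'
  have hs₁ : ∀ ω, G₁ ω ≠ 0 → κ / 2 ≤ ω ∧ ω ≤ 1 - κ / 2 := fun ω hω =>
    ⟨Set.mem_of_indicator_ne_zero hω, by
      by_contra! h
      exact hω (h₁.eq_zero ω (h.trans_le (le_abs_self ω)))⟩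
  have hs₂ : ∀ ω, G₂ ω ≠ 0 → κ / 2 ≤ -ω ∧ -ω ≤ 1 - κ / 2 := fun ω hω =>
    ⟨le_neg.1 (show ω ∈ {ω : ℝ | ω ≤ -(κ / 2)} from Set.mem_of_indicator_ne_zero hω), by
      by_contra! h
      exact hω (h₂.eq_zero ω (h.trans_le (neg_le_abs ω)))⟩
  have hw₁ : ∀ᵐ ω, ω ∉ Set.Ioc (0 : ℝ) (0 + 1) → G₁ ω = 0 :=
    Filter.Eventually.of_forall fun ω hn => by
      by_contra! h
      have := hs₁ ω h
      exact hn ⟨by linarith, by linarith⟩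
  have hw₂ : ∀ᵐ ω, ω ∉ Set.Ioc (-1 : ℝ) (-1 + 1) → G₂ ω = 0 :=
    Filter.Eventually.of_forall fun ω hn => by
      by_contra! h
      have := hs₂ ω h
      exact hn ⟨by linarith, by linarith⟩
  have hsum : G = G₀ + (G₁ + G₂) := by
    ext ω
    simp only [hG₀, hG₁, hG₂, Pi.add_apply, Set.indicator, Set.mem_ofPred_eq, abs_lt]
    split_ifs <;> first | (exfalso; grind) | simp
  have hadd : ∀ t, 𝓕⁻ G t = 𝓕⁻ G₀ t + (𝓕⁻ G₁ t + 𝓕⁻ G₂ t) := fun t => by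
    rw [hsum, h₀.fourierInv_add (h₁.add h₂), h₁.fourierInv_add h₂]
  have hS₀ := hasSum_circleLift h₀.memLp h₀.ae_notMem_Ioc
  have hS := hS₀.add ((hasSum_circleLift h₁.memLp hw₁).add (hasSum_circleLift h₂.memLp hw₂))
  refine ⟨c, _, _, hS.congr_fun fun n => ?_, hS₀.congr_fun fun n => ?_, ?_⟩
  · simp only [hadd, add_sub_cancel_left, add_smul]
  · simp only [add_sub_cancel_left]
  · filter_upwards [(memLp_circleLift h₀.memLp (-(1 / 2))).coeFn_toLp,
      (memLp_circleLift h₁.memLp 0).coeFn_toLp, (memLp_circleLift h₂.memLp (-1)).coeFn_toLp,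
      Lp.coeFn_add (memLp_circleLift h₀.memLp (-(1 / 2))).toLp
        ((memLp_circleLift h₁.memLp 0).toLp + (memLp_circleLift h₂.memLp (-1)).toLp),
      Lp.coeFn_add (memLp_circleLift h₁.memLp 0).toLp (memLp_circleLift h₂.memLp (-1)).toLp]
      with θ e₀ e₁ e₂ e₃ e₄
    by_cases hθ : ‖θ‖ < κ * Real.pi
    · rw [Set.indicator_of_mem (by exact hθ), e₃, Pi.add_apply, e₄, Pi.add_apply, e₁, e₂]
      have z₁ : circleLift 0 G₁ θ = 0 := by
        obtain ⟨ω, hω, rfl⟩ := exists_coe_eq 0 θ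
        rw [circleLift_coe hω]
        by_contra! h
        have := hs₁ ω h
        have := le_norm_coe_two_pi_mul this.1 this.2 (by positivity)
        linarith
      have z₂ : circleLift (-1) G₂ θ = 0 := by
        obtain ⟨ω, hω, rfl⟩ := exists_coe_eq (-1) θ
        rw [circleLift_coe hω]
        by_contra! h
        have := hs₂ ω h
        have := le_norm_coe_two_pi_mul this.1 this.2 (by positivity)
        rw [mul_neg, AddCircle.coe_neg, norm_neg] at this
        linarith
      rw [z₁, z₂, add_zero, add_zero]
    · rw [Set.indicator_of_notMem (by exact hθ), e₀]
      obtain ⟨ω, hω, rfl⟩ := exists_coe_eq (-(1 / 2)) θ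
      rw [circleLift_coe hω]
      refine Set.indicator_of_notMem (fun h => hθ ?_) _
      have h' : |ω| < κ / 2 := h
      rw [norm_coe_two_pi_mul (abs_le.2 ⟨hω.1.le, by linarith [hω.2]⟩)]
      nlinarith [Real.pi_pos]

theorem LowPass.unique {κ : ℝ} {x y y' : ℤ → ℂ} (h : LowPass κ x y) (h' : LowPass κ x y') :
    y = y' := by
  obtain ⟨c, U, V, hU, hV, hUV⟩ := h
  obtain ⟨c', U', V', hU', hV', hUV'⟩ := h'
  obtain ⟨rfl, rfl⟩ := hU.unique hU'
  obtain rfl : V = V' := Lp.ext (hUV.trans hUV'.symm)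
  exact hV.signal_unique hV'

/-! ### Interpolants and fractional translation -/

theorem IsInterpolant.unit {T : ℝ} (hT : 0 < T) {x : ℤ → ℂ} {z : ℝ → ℂ}
    (h : IsInterpolant T x z) : IsInterpolant 1 x fun t => z (T * t) := by
  obtain ⟨⟨c, Z, hZ, hZ0, hz⟩, hx⟩ := h
  have hb := BandSpectrum.dilate ⟨hZ, hZ0⟩ hT
  rw [show 1 / (2 * T) * T = 1 / (2 * 1) by field_simp] at hb
  refine ⟨⟨c, dilate T Z, hb.memLp, hb.eq_zero, fun t => ?_⟩, fun n => ?_⟩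
  · rw [fourierInv_dilate hT, ← hz]
  · simp only [mul_one, mul_comm T, hx]

/-- Rescale to period one. Uniqueness of the DTFT equates the constants, and the sinc series
recovers the rest from the samples. -/
theorem IsInterpolant.unique {T : ℝ} (hT : 0 < T) {x : ℤ → ℂ} {z z' : ℝ → ℂ}
    (h : IsInterpolant T x z) (h' : IsInterpolant T x z') : z = z' := by
  obtain ⟨⟨c, Z, hZ, hZ0, hz⟩, hx⟩ := h.unit hT
  obtain ⟨⟨c', Z', hZ', hZ0', hz'⟩, hx'⟩ := h'.unit hT
  rw [show (1 / (2 * 1) : ℝ) = 1 / 2 by norm_num] at hZ0 hZ0'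
  have hB : BandSpectrum (1 / 2) Z := ⟨hZ, hZ0⟩
  have hB' : BandSpectrum (1 / 2) Z' := ⟨hZ', hZ0'⟩
  have e : (fun n : ℤ => c + 𝓕⁻ Z n) = x := by
    ext n
    rw [← hz, ← hx n, mul_one]
  have e' : (fun n : ℤ => c' + 𝓕⁻ Z' n) = x := by
    ext n
    rw [← hz', ← hx' n, mul_one]
  obtain ⟨U, hU⟩ := hB.exists_hasDTFT c
  obtain ⟨U', hU'⟩ := hB'.exists_hasDTFT c'
  rw [e] at hU
  rw [e'] at hU'
  obtain ⟨rfl, -⟩ := hU.unique hU'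
  have hn : ∀ n : ℤ, 𝓕⁻ Z n = 𝓕⁻ Z' n := fun n =>
    add_left_cancel (congrFun (e.trans e'.symm) n)
  have hs : ∀ t, 𝓕⁻ Z t = 𝓕⁻ Z' t := fun t =>
    (hB.hasSum_sinc t).unique ((hB'.hasSum_sinc t).congr_fun fun n => by rw [hn])
  ext t
  have := hz (t / T)
  rw [hs, ← hz'] at this
  simpa only [mul_div_cancel₀ _ hT.ne'] using this

theorem BandSpectrum.isInterpolant {T : ℝ} (hT : 0 < T) {Z : ℝ → ℂ} (hZ : BandSpectrum (1 / 2) Z)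
    (c : ℂ) : IsInterpolant T (fun n => c + 𝓕⁻ Z n) fun t => c + 𝓕⁻ Z (t / T) := by
  have hb := hZ.dilate (inv_pos.2 hT)
  rw [show 1 / 2 * T⁻¹ = 1 / (2 * T) by field_simp] at hb
  refine ⟨⟨c, AliasFree.dilate T⁻¹ Z, hb.memLp, hb.eq_zero, fun t => ?_⟩, fun n => ?_⟩
  · rw [fourierInv_dilate (inv_pos.2 hT), inv_mul_eq_div]
  · simp only [mul_div_cancel_right₀ _ hT.ne']

theorem BandSpectrum.isValueAt_fracTranslate {T : ℝ} (hT : 0 < T) (Δ : ℝ) {Z : ℝ → ℂ}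
    (hZ : BandSpectrum (1 / 2) Z) (c : ℂ) :
    IsValueAt (FracTranslate T Δ) (fun n => c + 𝓕⁻ Z n) fun n => c + 𝓕⁻ Z (n + Δ / T) := by
  have hi := hZ.isInterpolant hT c
  have hv : ∀ n : ℤ, (n * T + Δ) / T = n + Δ / T := fun n => by field_simp
  refine fun v => ⟨fun ⟨z, hz, hzv⟩ => ?_, fun hv' => ⟨_, hi, fun n => ?_⟩⟩
  · ext n
    simp only [hzv, hz.unique hT hi, hv]
  · simp only [hv', hv]

/-! ### The activation in continuous time, and equivariance -/

/-- The alias-free polynomial activation, computed in continuous time: low-pass filtering of the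
polynomial of the band-limited interpolant. -/
theorem BandSpectrum.isValueAt_aliasFreePoly {d : ℕ} {p : Polynomial ℂ} {Z G : ℝ → ℂ} {c : ℂ}
    (hZ : BandSpectrum (1 / 2) Z) (hG : BandSpectrum (1 - 2 / ((d : ℝ) + 1) / 2) G)
    (h : ∀ t, p.eval (𝓕⁻ Z (t / (((d : ℝ) + 1) / 2))) = c + 𝓕⁻ G t) :
    IsValueAt (AliasFreePoly d p) (fun n => 𝓕⁻ Z n) fun n =>
      c + 𝓕⁻ ({ω : ℝ | |ω| < 2 / ((d : ℝ) + 1) / 2}.indicator G) (((d : ℝ) + 1) / 2 * n) := by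
  have hκ : 0 < 2 / ((d : ℝ) + 1) := by positivity
  have hup : Upsample (((d : ℝ) + 1) / 2) (fun n => 𝓕⁻ Z n)
      fun m => 𝓕⁻ Z (m / (((d : ℝ) + 1) / 2)) := fun m => hZ.hasSum_sinc _
  have hlow := lowPass_fourierInv hκ hG c
  have hG₀ : BandSpectrum (1 / 2) ({ω : ℝ | |ω| < 2 / ((d : ℝ) + 1) / 2}.indicator G) :=
    hG.indicator (measurableSet_lt (by fun_prop) (by fun_prop)) fun ω h h' => by
      have : |ω| < 2 / ((d : ℝ) + 1) / 2 := h
      linarith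
  have hi := hG₀.isInterpolant one_pos c
  refine fun v => ⟨fun ⟨xUp, yLPF, h1, h2, z, hz, hzv⟩ => ?_, fun hv =>
    ⟨_, _, hup, ?_, _, hi, fun n => ?_⟩⟩
  · obtain rfl : xUp = _ := funext fun m => (h1 m).unique (hup m)
    simp only [h] at h2
    obtain rfl := h2.unique hlow
    ext n
    simp only [hzv, hz.unique one_pos hi, div_one]
  · simpa only [h] using hlow
  · simp only [hv, div_one]

end AliasFree

open AliasFree in
theorem mainTheorem1 (T : ℝ) (hT : 0 < T) (d : ℕ) (p : Polynomial ℂ) (hp : p.natDegree ≤ d) :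
    AliasFree.ShiftEquivariant T (AliasFree.AliasFreePoly d p) := by
  intro x hx Δ
  obtain ⟨Z, hZ, hZx⟩ := exists_bandSpectrum hx
  obtain rfl : (fun n : ℤ => 𝓕⁻ Z n) = x := funext hZx
  have hd : (0 : ℝ) < (d : ℝ) + 1 := by positivity
  set I : ℝ := ((d : ℝ) + 1) / 2 with hI
  have hIpos : 0 < I := by positivity
  obtain ⟨c, G, hG, hpG⟩ := (hZ.dilate (inv_pos.2 hIpos)).exists_polynomial (by positivity) d p hp
  -- Here `1 / (2I) = 1 / (d + 1)`, so the band is `d / (d + 1) = 1 - κ / 2`: the low-pass lemma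
  -- applies with no slack.
  rw [show d * (1 / 2 * I⁻¹) = 1 - 2 / ((d : ℝ) + 1) / 2 by rw [hI]; field_simp; ring] at hG
  have hpG' : ∀ t, p.eval (𝓕⁻ Z (t / I)) = c + 𝓕⁻ G t := fun t => by
    rw [← hpG, fourierInv_dilate (inv_pos.2 hIpos), inv_mul_eq_div]
  have hZ' := hZ.modulate (Δ / T)
  -- A shift by `Δ / T` samples is `I` times as many upsampled samples.
  have hG' := hG.modulate (I * (Δ / T))
  set G₀ := {ω : ℝ | |ω| < 2 / ((d : ℝ) + 1) / 2}.indicator G with hG₀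
  -- Downsampling by `I` stretches the cutoff `1 / (d + 1)` to exactly `1 / 2`, so the output is
  -- itself interpolable.
  have hB : BandSpectrum (1 / 2) (dilate I G₀) := by
    have h : BandSpectrum (2 / ((d : ℝ) + 1) / 2) G₀ :=
      hG.indicator (measurableSet_lt (by fun_prop) (by fun_prop)) fun ω h _ => le_of_lt h
    convert! h.dilate hIpos using 1
    rw [hI]
    field_simp
  refine ⟨fun n => 𝓕⁻ (modulate (Δ / T) Z) n, fun n => c + 𝓕⁻ (dilate I G₀) n,
    fun n => c + 𝓕⁻ (dilate I G₀) (n + Δ / T), ?_, ?_, ?_, ?_,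
    hB.isValueAt_fracTranslate hT Δ c⟩
  · obtain ⟨U, hU⟩ := hZ'.exists_hasDTFT 0
    simpa using hU.memℓp
  · simpa [fourierInv_modulate] using hZ.isValueAt_fracTranslate hT Δ 0
  · simp only [fourierInv_dilate hIpos]
    exact hZ.isValueAt_aliasFreePoly hG hpG'
  · have := hZ'.isValueAt_aliasFreePoly (p := p) (c := c) hG' fun t => by
      rw [fourierInv_modulate, fourierInv_modulate, ← hpG']
      congr 2
      rw [← hI]
      field_simp
    rw [indicator_modulate, ← hG₀] at this
    simpa only [fourierInv_dilate hIpos, fourierInv_modulate, mul_add] using this
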